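/- Fix a universal machine $U$, with respect to which conditional Kolmogorov complexity $C(x\mid y)$ is defined, and a universal machine $R$, in whose language local routing functions are stored (here a machine maps a binary program and an input to at most one output, and it is universal if it is partial recursive and can simulate every partial recursive machine $V$, translating each program of $V$ into one that is longer by at most a constant depending only on $V$; $U=R$ is allowed). Write $\log$ for the binary logarithm. For a graph $G$ with node set $\{1,\dots,n\}$ let $E(G)\in\{0,1\}^{n(n-1)/2}$ be the string that lists, in lexicographic order of the pairs $u<v$, whether $\{u,v\}$ is an edge. $G$ is $\delta$-random if $C(E(G)\mid n,a)\ge n(n-1)/2-\delta$, where $a$ is the description of $\delta$ and of the family of all labelled graphs that is supplied along with $n$. Routing takes place in the model in which nodes know their neighbours: node $u$ knows for free its own label and the labels of its neighbours, each incident edge carries the label of the neighbour it leads to, and nodes are not relabelled. Node $u$ stores a binary string $F(u)$, a program for $R$; given the label of $u$, the list of labels of its neighbours and the label of a destination $v\ne u$, it has to output the label of the neighbour of $u$ to which a message for $v$ is forwarded. The cost at $u$ is the length $|F(u)|$. The scheme $F$ has stretch at most $s$ if for all $u\neq v$ the route it produces from $u$ reaches $v$ after at most $s\cdot d_G(u,v)$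 edges. **Theorem.** Let $c\ge 0$ be a real constant. There is $n_0$ (depending only on $c$, $U$, $R$) such that for every $n\ge n_0$, every description $a$, and every $c\log n$-random graph $G$ on $\{1,\dots,n\}$, there are a routing scheme $F$ and a set $B$ of nodes (the routing centres) with the following properties. 1. $F$ has stretch at most $1.5$. 2. $|B|\le 1+(c+3)\log n$. 3. $|F(u)|\le\lceil\log(n+1)\rceil$ for every node $u\notin B$. 4. $|F(u)|\le 3n$ for every node $u\in B$. 5. The complete routing scheme takes $\sum_u|F(u)|<(3c+20)\,n\log n$ bits. -/

import Mathlib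

namespace CompactRouting

/-! ### Machines and conditional Kolmogorov complexity

Finite objects (strings, numbers, tuples, lists) are identified with natural numbers through
the standard computable codings `Encodable.encode`. -/

/-- A machine takes a binary program and an input and may halt with an output. -/
abbrev Machine : Type := List Bool → ℕ →. ℕ

/-- A universal machine: it is partial recursive, and it simulates every partial recursive
machine `V`, every program of `V` being translated into one that is at most a constant
(depending on `V` only) longer and that computes the same partial function of the input. -/
def Machine.IsUniversal (U : Machine) : Prop :=
  Partrec₂ U ∧
    ∀ V : Machine, Partrec₂ V →
      ∃ k : ℕ, ∀ p : List Bool, ∃ q : List Bool,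
        q.length ≤ p.length + k ∧ ∀ y : ℕ, U q y = V p y

/-- `C_U(x | y)`: the length of a shortest program from which `U` computes `x` given `y`.
For a universal `U` such a program exists for all `x` and `y`. -/
noncomputable def condComplexity (U : Machine) (x y : ℕ) : ℕ :=
  sInf {l : ℕ | ∃ p : List Bool, p.length = l ∧ x ∈ U p y}

/-- Splits the string `1^i 0 q` into `(i, q)`. -/
def splitIndex (p : List Bool) : ℕ × List Bool :=
  List.rec (0, []) (fun b l r => bif b then (r.1 + 1, r.2) else (0, l)) p

/-- A concrete machine: on the program `1^i 0 q` and the input `y` it runs the `i`-th partial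
recursive function on the pair `(q, y)`. -/
def referenceMachine : Machine := fun p y =>
  (Denumerable.ofNat Nat.Partrec.Code (splitIndex p).1).eval
    (Encodable.encode ((splitIndex p).2, y))

theorem splitIndex_append (i : ℕ) (q : List Bool) :
    splitIndex (List.replicate i true ++ false :: q) = (i, q) := by
  induction i with
  | zero => rfl
  | succ i ih =>
    rw [List.replicate_succ, List.cons_append]
    change ((splitIndex (List.replicate i true ++ false :: q)).1 + 1,
      (splitIndex (List.replicate i true ++ false :: q)).2) = (i + 1, q)
    rw [ih]

theorem computable_splitIndex : Computable splitIndex := by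
  apply Primrec.to_comp
  have h : Primrec₂ fun (_ : List Bool) (x : Bool × List Bool × (ℕ × List Bool)) =>
      bif x.1 then (x.2.2.1 + 1, x.2.2.2) else (0, x.2.1) := by
    refine Primrec.cond (Primrec.fst.comp Primrec.snd) (Primrec.pair ?_ ?_) (Primrec.pair ?_ ?_)
    · exact Primrec.succ.comp (Primrec.fst.comp (Primrec.snd.comp (Primrec.snd.comp Primrec.snd)))
    · exact Primrec.snd.comp (Primrec.snd.comp (Primrec.snd.comp Primrec.snd))
    · exact Primrec.const 0
    · exact Primrec.fst.comp (Primrec.snd.comp Primrec.snd)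
  exact Primrec.list_rec Primrec.id (Primrec.const ((0 : ℕ), ([] : List Bool))) h

/-- Universal machines exist. -/
theorem referenceMachine_isUniversal : referenceMachine.IsUniversal := by
  constructor
  · have hs : Computable fun x : List Bool × ℕ => splitIndex x.1 :=
      computable_splitIndex.comp Computable.fst
    exact Nat.Partrec.Code.eval_part.comp
      ((Computable.ofNat Nat.Partrec.Code).comp (Computable.fst.comp hs))
      (Computable.encode.comp (Computable.pair (Computable.snd.comp hs) Computable.snd))
  · intro V hV
    obtain ⟨code, hcode⟩ := Nat.Partrec.Code.exists_code.1 hV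
    refine ⟨Encodable.encode code + 1, fun p =>
      ⟨List.replicate (Encodable.encode code) true ++ false :: p, ?_, fun y => ?_⟩⟩
    · simp; omega
    · unfold referenceMachine
      rw [splitIndex_append]
      simp only [Denumerable.ofNat_encode]
      rw [hcode]
      simp [Encodable.encodek, Part.map_id']

/-! ### Labelled graphs and their randomness deficiency -/

/-- The nodes of a graph on `n` nodes carry the labels `1, …, n`. -/
def label {n : ℕ} (u : Fin n) : ℕ := u.val + 1

open Classical in
/-- The string `E(G)` of length `n(n-1)/2`: one bit for each possible edge `{u, v}`, `u < v`, in
lexicographic order, which is `1` iff the edge is present. -/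
noncomputable def edgeString {n : ℕ} (G : SimpleGraph (Fin n)) : List Bool :=
  (List.finRange n).flatMap fun u =>
    ((List.finRange n).filter fun v => u < v).map fun v => decide (G.Adj u v)

/-- `G` has randomness deficiency at most `δ` in the family of all labelled graphs on `n` nodes:
`C(E(G) | n, a) ≥ n(n-1)/2 - δ`. The number `a` stands for whatever finite description of the
function `δ` and of the family of graphs is supplied along with `n`. -/
def IsRandomGraph (U : Machine) (a : ℕ) (δ : ℝ) {n : ℕ} (G : SimpleGraph (Fin n)) : Prop :=
  (n : ℝ) * ((n : ℝ) - 1) / 2 - δ ≤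
    (condComplexity U (Encodable.encode (edgeString G)) (Encodable.encode (n, a)) : ℝ)

/-! ### Routing when the neighbours are known and nodes are not relabelled -/

open Classical in
/-- The labels of the neighbours of `u`, in increasing order. -/
noncomputable def neighbourLabels {n : ℕ} (G : SimpleGraph (Fin n)) (u : Fin n) : List ℕ :=
  ((List.finRange n).filter fun v => G.Adj u v).map label

/-- `F u` is the string stored at node `u`, a program in the language `R` for the local routing
function of `u`. For free the node knows its own label and the labels of its neighbours.
`Forwards R G F v u w`: at `u`, a message with destination `v` is sent over the edge to the
neighbour `w`. -/
def Forwards (R : Machine) {n : ℕ} (G : SimpleGraph (Fin n)) (F : Fin n → List Bool)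
    (v u w : Fin n) : Prop :=
  G.Adj u w ∧
    label w ∈ R (F u) (Encodable.encode (label u, neighbourLabels G u, label v))

/-- `Route R G F v u k`: the route from `u` to `v` that the routing scheme `F` produces reaches
`v` after exactly `k` edges. -/
inductive Route (R : Machine) {n : ℕ} (G : SimpleGraph (Fin n)) (F : Fin n → List Bool)
    (v : Fin n) : Fin n → ℕ → Prop
  | arrive : Route R G F v v 0
  | step {u w : Fin n} {k : ℕ} (hne : u ≠ v) (hfwd : Forwards R G F v u w)
      (hrest : Route R G F v w k) : Route R G F v u (k + 1)

/-- The scheme `F` routes between all pairs of distinct nodes, and the length of each route is at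
most `s` times the distance of its endpoints. -/
def HasStretchAtMost (R : Machine) {n : ℕ} (G : SimpleGraph (Fin n)) (F : Fin n → List Bool)
    (s : ℝ) : Prop :=
  ∀ u v : Fin n, u ≠ v → ∃ k : ℕ, Route R G F v u k ∧ (k : ℝ) ≤ s * (G.dist u v : ℝ)

end CompactRouting

/-! The proof is an incompressibility argument. Let `q = ⌈c⌉`. If a decidable property holds for a
fraction `ε n` of all graphs with `n ^ q * ε n → 0`, a graph with the property is described by its
rank among the strings that have it. This saves more than `c log n` bits, so no `c log n`-random
graph on many nodes has the property (`eventually_not_bad_of_isRandomGraph`).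

Three rare properties are excluded in this way. With `m = (q + 2) * Nat.log 2 n`: some node outside
the first `m` has no neighbour among them; some two nodes have no common neighbour; some node needs
more than `3n - k` bits to record in unary, for every `v`, the place in its neighbour list of the
first neighbour adjacent to `v`. The counts replace independence of edges by toggling one pair of
nodes at a time. For the third, the code length is a sum of essentially geometric variables, and its
exponential moment with base `4/3` is at most `2 ^ n` (`sum_pow_relayIndex_le`).

The centres are the first `m` nodes, which store this unary code; all others store a translation of
the empty program. Every node delivers directly to a neighbour. Otherwise a centre uses its recorded
relay and needs two steps, and any other node forwards to its least neighbour, which is a centre,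
and so needs at most three. Non-adjacent nodes are at distance at least two, whence the stretch
`3/2`. -/

namespace CompactRouting

open Filter Topology

/-! ### Primitive recursive list operations -/

section Primrec

variable {α β : Type*} [Primcodable α] [Primcodable β]

theorem primrec_filter {f : α → List β} {p : α → β → Bool} (hf : Primrec f) (hp : Primrec₂ p) :
    Primrec fun a => (f a).filter (p a) := by
  have h : Primrec₂ fun (a : α) (b : β) => bif p a b then some b else none :=
    Primrec.cond hp (Primrec.option_some.comp Primrec.snd) (Primrec.const none)
  refine (Primrec.listFilterMap hf h).of_eq fun a => ?_
  rw [← List.filterMap_eq_filter]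
  congr 1
  funext b
  cases h : p a b <;> simp [Option.guard, h]

theorem primrec_any {f : α → List β} {p : α → β → Bool} (hf : Primrec f) (hp : Primrec₂ p) :
    Primrec fun a => (f a).any (p a) := by
  have h : PrimrecPred fun a => (f a).findIdx (p a) < (f a).length :=
    PrimrecRel.comp Primrec.nat_lt (Primrec.list_findIdx hf hp) (Primrec.list_length.comp hf)
  refine h.decide.of_eq fun a => ?_
  rw [Bool.eq_iff_iff, decide_eq_true_iff, List.findIdx_lt_length, List.any_eq_true]

theorem primrec_all {f : α → List β} {p : α → β → Bool} (hf : Primrec f) (hp : Primrec₂ p) :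
    Primrec fun a => (f a).all (p a) := by
  refine (Primrec.not.comp (primrec_any hf (Primrec.not.comp₂ hp))).of_eq fun a => ?_
  rw [List.not_any_eq_all_not]
  simp only [Bool.not_not]

theorem primrec_replicate {f : α → ℕ} (hf : Primrec f) (b : β) :
    Primrec fun a => List.replicate (f a) b :=
  (Primrec.list_map (Primrec.list_range.comp hf) (Primrec.const b).to₂).of_eq fun a => by
    simp [List.map_const']

theorem primrec_idxOf [BEq α] [LawfulBEq α] : Primrec₂ (List.idxOf : α → List α → ℕ) := by
  classical
  have h := Primrec.list_idxOf (α := α)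
  rwa [lawful_beq_subsingleton instBEqOfDecidableEq (inferInstanceAs (BEq α))] at h

end Primrec

theorem primrec_two_pow : Primrec fun k : ℕ => 2 ^ k :=
  (Primrec.nat_rec₁ 1 (Primrec.nat_double.comp Primrec.snd).to₂).of_eq fun k => by
    induction k with
    | zero => rfl
    | succ k ih => simp only [ih, pow_succ]; ring

theorem primrec_log_two : Primrec (Nat.log 2) := by
  have h : PrimrecRel fun n k : ℕ => 2 ^ k ≤ n :=
    PrimrecRel.comp Primrec.nat_le (primrec_two_pow.comp Primrec.snd) Primrec.fst
  refine (Primrec.nat_findGreatest Primrec.id h).of_eq fun n => ?_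
  rw [Nat.findGreatest_eq_iff]
  refine ⟨Nat.log_le_self 2 n, fun h0 => Nat.pow_log_le_self 2 fun hn => ?_, fun k hk _ => ?_⟩
  · simp [hn] at h0
  · exact not_le.2 (Nat.lt_pow_of_log_lt one_lt_two hk)

/-! ### Pairs of nodes and binary strings as computable lists -/

/-- All pairs `u < v < n` in lexicographic order. -/
def labelPairs (n : ℕ) : List (ℕ × ℕ) :=
  (List.range n).flatMap fun u => ((List.range n).filter fun v => decide (u < v)).map fun v => (u, v)

theorem primrec_labelPairs : Primrec labelPairs := by
  refine Primrec.list_flatMap Primrec.list_range ?_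
  refine Primrec.list_map (primrec_filter (Primrec.list_range.comp Primrec.fst) ?_) ?_
  · exact (PrimrecRel.comp Primrec.nat_lt (Primrec.snd.comp Primrec.fst) Primrec.snd).decide
  · exact Primrec.pair (Primrec.snd.comp Primrec.fst) Primrec.snd

theorem mem_labelPairs {n : ℕ} {e : ℕ × ℕ} : e ∈ labelPairs n ↔ e.1 < e.2 ∧ e.2 < n := by
  obtain ⟨u, v⟩ := e
  simp only [labelPairs, List.mem_flatMap, List.mem_range, List.mem_map, List.mem_filter,
    decide_eq_true_eq, Prod.mk.injEq]
  constructor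
  · rintro ⟨_, _, _, ⟨h1, h2⟩, rfl, rfl⟩
    exact ⟨h2, h1⟩
  · rintro ⟨h1, h2⟩
    exact ⟨u, h1.trans h2, v, ⟨h2, h1⟩, rfl, rfl⟩

theorem nodup_labelPairs (n : ℕ) : (labelPairs n).Nodup := by
  refine List.nodup_flatMap.2 ⟨fun u _ => ?_, ?_⟩
  · exact (List.nodup_range.filter _).map fun a b h => (Prod.mk.inj h).2
  · refine List.nodup_range.imp fun {a b} hab => ?_
    intro x hx hy
    simp only [List.mem_map] at hx hy
    obtain ⟨_, _, rfl⟩ := hx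
    obtain ⟨_, _, h⟩ := hy
    exact hab (Prod.mk.inj h).1.symm

theorem length_labelPairs (n : ℕ) : ((labelPairs n).length : ℝ) = (n : ℝ) * ((n : ℝ) - 1) / 2 := by
  have h : (labelPairs n).length = n * (n - 1) / 2 := by
    -- The row of `u` has `n - 1 - u` pairs, so the total is the sum over `range n` reflected.
    rw [← Finset.sum_range_id_mul_two, Nat.mul_div_cancel _ two_pos, labelPairs,
      List.length_flatMap, ← Finset.sum_range_reflect, Finset.sum_range, ← List.sum_ofFn]
    congr 1
    rw [List.ofFn_eq_map, ← List.map_coe_finRange_eq_range, List.map_map]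
    refine List.map_congr_left fun u _ => ?_
    simp only [Function.comp, List.length_map]
    have hu : (Finset.range n).filter (fun v => (u : ℕ) < v) = Finset.Ioo (u : ℕ) n := by
      ext v; simp [and_comm]
    have h2 := congrArg Finset.card hu
    rw [Nat.card_Ioo] at h2
    rw [show n - 1 - (u : ℕ) = n - u - 1 by omega, ← h2, List.map_coe_finRange_eq_range]
    rfl
  have h2 : 2 * (labelPairs n).length = n * (n - 1) := by
    rw [h, Nat.two_mul_div_two_of_even (Nat.even_mul_pred_self n)]
  rcases n with _ | n
  · simpa using h2
  · have h3 := congrArg (Nat.cast : ℕ → ℝ) h2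
    push_cast [Nat.add_sub_cancel] at h3
    push_cast
    linarith

/-- All binary strings of length `k`. -/
def boolLists (k : ℕ) : List (List Bool) :=
  Nat.rec [[]] (fun _ r => r.map (List.cons false) ++ r.map (List.cons true)) k

theorem boolLists_succ (k : ℕ) : boolLists (k + 1) =
    (boolLists k).map (List.cons false) ++ (boolLists k).map (List.cons true) := rfl

theorem primrec_boolLists : Primrec boolLists := by
  refine Primrec.nat_rec₁ _ ?_
  exact Primrec.list_append.comp
    (Primrec.list_map Primrec.snd (Primrec.list_cons.comp (Primrec.const false) Primrec.snd).to₂)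
    (Primrec.list_map Primrec.snd (Primrec.list_cons.comp (Primrec.const true) Primrec.snd).to₂)

theorem mem_boolLists {k : ℕ} {s : List Bool} : s ∈ boolLists k ↔ s.length = k := by
  induction k generalizing s with
  | zero => simp [boolLists]
  | succ k ih =>
    rw [boolLists_succ, List.mem_append, List.mem_map, List.mem_map]
    rcases s with _ | ⟨b, s⟩
    · simp
    · cases b <;> simp [ih]

theorem nodup_boolLists (k : ℕ) : (boolLists k).Nodup := by
  induction k with
  | zero => simp [boolLists]
  | succ k ih =>
    rw [boolLists_succ]
    refine (ih.map (List.cons_injective)).append (ih.map (List.cons_injective)) ?_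
    intro x hx hy
    simp only [List.mem_map] at hx hy
    obtain ⟨_, _, rfl⟩ := hx
    obtain ⟨_, _, h⟩ := hy
    simp at h

theorem length_boolLists (k : ℕ) : (boolLists k).length = 2 ^ k := by
  induction k with
  | zero => rfl
  | succ k ih => rw [boolLists_succ]; simp [ih, pow_succ]; ring

/-! ### Compressing the members of small decidable families -/

/-- Serves twice: for the machine that measures complexity, and for the machine in whose language
the routing functions are stored. -/
theorem exists_simulation {U : Machine} (hU : U.IsUniversal) {f : List Bool → ℕ → ℕ}
    (hf : Primrec₂ f) : ∃ k : ℕ, ∀ p : List Bool, ∃ q : List Bool,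
      q.length ≤ p.length + k ∧ ∀ y : ℕ, U q y = Part.some (f p y) :=
  hU.2 (fun p y => Part.some (f p y)) (Computable₂.partrec₂ (Primrec₂.to_comp hf))

theorem condComplexity_le {U : Machine} (hU : U.IsUniversal) {f : List Bool → ℕ → ℕ}
    (hf : Primrec₂ f) : ∃ k : ℕ, ∀ (p : List Bool) (y : ℕ),
      condComplexity U (f p y) y ≤ p.length + k := by
  obtain ⟨k, hk⟩ := exists_simulation hU hf
  refine ⟨k, fun p y => ?_⟩
  obtain ⟨q, hq, h⟩ := hk p
  have hmem : f p y ∈ U q y := by rw [h]; exact Part.mem_some _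
  exact (Nat.sInf_le (show q.length ∈ {l | ∃ p', p'.length = l ∧ f p y ∈ U p' y} from
    ⟨q, rfl, hmem⟩)).trans hq

/-- The strings of length `n(n-1)/2` that satisfy `bad`. -/
def badStrings (bad : ℕ → List Bool → Bool) (n : ℕ) : List (List Bool) :=
  (boolLists (labelPairs n).length).filter (bad n)

/-- A string that belongs to a decidable family of at most `2 ^ l` strings has complexity
`l + O(1)`. -/
theorem condComplexity_le_of_bad {U : Machine} (hU : U.IsUniversal)
    {bad : ℕ → List Bool → Bool} (hbad : Primrec₂ bad) :
    ∃ k : ℕ, ∀ (n a l : ℕ) (s : List Bool), s ∈ badStrings bad n →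
      (badStrings bad n).length ≤ 2 ^ l →
      condComplexity U (Encodable.encode s) (Encodable.encode (n, a)) ≤ l + k := by
  have hlist : Primrec (badStrings bad) :=
    primrec_filter (primrec_boolLists.comp (Primrec.list_length.comp primrec_labelPairs)) hbad
  -- A program is read as its rank among the strings of its own length, so exactly `l` bits address
  -- `2 ^ l` members. The component `a` of the input is ignored, which makes the constant
  -- independent of it.
  have hf : Primrec₂ fun (p : List Bool) (y : ℕ) => Encodable.encode
      ((badStrings bad (Denumerable.ofNat (ℕ × ℕ) y).1).getD
        ((boolLists p.length).idxOf p) []) := by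
    have h1 : Primrec fun x : List Bool × ℕ =>
        badStrings bad (Denumerable.ofNat (ℕ × ℕ) x.2).1 :=
      hlist.comp (Primrec.fst.comp ((Primrec.ofNat (ℕ × ℕ)).comp Primrec.snd))
    have h2 : Primrec fun x : List Bool × ℕ => (boolLists x.1.length).idxOf x.1 :=
      primrec_idxOf.comp Primrec.fst
        (primrec_boolLists.comp (Primrec.list_length.comp Primrec.fst))
    exact Primrec.encode.comp ((Primrec.list_getD ([] : List Bool)).comp h1 h2)
  obtain ⟨k, hk⟩ := condComplexity_le hU hf
  refine ⟨k, fun n a l s hs hl => ?_⟩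
  obtain ⟨j, hj, rfl⟩ := List.mem_iff_getElem.1 hs
  have hj' : j < (boolLists l).length := by rw [length_boolLists]; exact hj.trans_le hl
  have hlen : ((boolLists l)[j]).length = l := mem_boolLists.1 (List.getElem_mem hj')
  have h := hk (boolLists l)[j] (Encodable.encode (n, a))
  rw [hlen, (nodup_boolLists l).idxOf_getElem, Denumerable.ofNat_encode,
    List.getD_eq_getElem _ _ hj] at h
  exact h

/-! ### Counting graphs one pair of nodes at a time -/

section Counting

open Classical

variable {V : Type*}

/-- `G` with the status of the pair `{u, v}` reversed. -/
def toggle (u v : V) (G : SimpleGraph V) : SimpleGraph V := symmDiff G (SimpleGraph.edge u v)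

theorem toggle_toggle (u v : V) (G : SimpleGraph V) : toggle u v (toggle u v G) = G :=
  symmDiff_symmDiff_cancel_right _ _

theorem toggle_adj_self {u v : V} (huv : u ≠ v) (G : SimpleGraph V) :
    (toggle u v G).Adj u v ↔ ¬ G.Adj u v := by
  simp [toggle, symmDiff, SimpleGraph.sup_adj, SimpleGraph.sdiff_adj, SimpleGraph.edge_adj, huv]

theorem toggle_adj_of_ne {u v a b : V} (h : s(a, b) ≠ s(u, v)) (G : SimpleGraph V) :
    (toggle u v G).Adj a b ↔ G.Adj a b := by
  have h' : ¬ (SimpleGraph.edge u v).Adj a b := by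
    rw [SimpleGraph.adj_edge]
    exact fun h2 => h h2.1.symm
  simp [toggle, symmDiff, SimpleGraph.sup_adj, SimpleGraph.sdiff_adj, h']

/-- The number of elements of `xs` that precede the first neighbour of `v`. -/
noncomputable def firstIndex (G : SimpleGraph V) (xs : List V) (v : V) : ℕ :=
  xs.findIdx fun x => decide (G.Adj x v)

theorem firstIndex_toggle {G : SimpleGraph V} {xs : List V} {u v w : V}
    (h : ∀ x ∈ xs, s(x, w) ≠ s(u, v)) : firstIndex (toggle u v G) xs w = firstIndex G xs w := by
  unfold firstIndex
  induction xs with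
  | nil => rfl
  | cons x xs ih =>
    rw [List.forall_mem_cons] at h
    simp only [List.findIdx_cons, ih h.2, toggle_adj_of_ne h.1]

variable [Fintype V]

/-- Toggling `{u, v}` matches the graphs with this edge to those without it, and `h` agrees on
matched graphs. This is independence of `h` from an edge of probability `1/2`. -/
theorem sum_adj_mul {u v : V} (huv : u ≠ v) {h : SimpleGraph V → ℝ}
    (hh : ∀ G, h (toggle u v G) = h G) :
    ∑ G : SimpleGraph V, (if G.Adj u v then 1 else 0) * h G = (∑ G, h G) / 2 := by
  have h1 : ∑ G : SimpleGraph V, (if G.Adj u v then (1 : ℝ) else 0) * h G =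
      ∑ G : SimpleGraph V, (if G.Adj u v then 0 else 1) * h G := by
    refine Fintype.sum_bijective (toggle u v)
      (Function.Involutive.bijective (toggle_toggle u v)) _ _ fun G => ?_
    simp only [toggle_adj_self huv, hh]
    split_ifs <;> simp_all
  have h2 : ∑ G, h G = ∑ G : SimpleGraph V, (if G.Adj u v then (1 : ℝ) else 0) * h G +
      ∑ G : SimpleGraph V, (if G.Adj u v then 0 else 1) * h G := by
    rw [← Finset.sum_add_distrib]
    refine Finset.sum_congr rfl fun G _ => ?_
    split_ifs <;> simp
  linarith

theorem sum_not_adj_mul {u v : V} (huv : u ≠ v) {h : SimpleGraph V → ℝ}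
    (hh : ∀ G, h (toggle u v G) = h G) :
    ∑ G : SimpleGraph V, (if G.Adj u v then 0 else 1) * h G = (∑ G, h G) / 2 := by
  have h2 : ∑ G, h G = ∑ G : SimpleGraph V, (if G.Adj u v then (1 : ℝ) else 0) * h G +
      ∑ G : SimpleGraph V, (if G.Adj u v then 0 else 1) * h G := by
    rw [← Finset.sum_add_distrib]
    refine Finset.sum_congr rfl fun G _ => ?_
    split_ifs <;> simp
  linarith [sum_adj_mul huv hh]

/-- The graphs in which `v` has no neighbour in `S`. -/
theorem card_no_neighbour_in {S : Finset V} {v : V} (hv : v ∉ S) :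
    ((Finset.univ.filter fun G : SimpleGraph V => ∀ x ∈ S, ¬ G.Adj x v).card : ℝ) =
      (1 / 2) ^ S.card * Fintype.card (SimpleGraph V) := by
  rw [Finset.card_filter]
  push_cast
  induction S using Finset.induction_on with
  | empty => simp [Finset.card_univ]
  | insert y S hy ih =>
    rw [Finset.mem_insert, not_or] at hv
    -- The condition on `S` does not involve the pair `{y, v}`, so the new condition halves the
    -- count.
    have h := sum_not_adj_mul (Ne.symm hv.1)
      (h := fun G => if ∀ x ∈ S, ¬ G.Adj x v then 1 else 0) fun G => by
        have : (∀ x ∈ S, ¬ (toggle y v G).Adj x v) ↔ ∀ x ∈ S, ¬ G.Adj x v := by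
          refine forall₂_congr fun x hx => not_congr (toggle_adj_of_ne (fun he => ?_) G)
          rcases Sym2.eq_iff.1 he with ⟨rfl, _⟩ | ⟨rfl, rfl⟩
          · exact hy hx
          · exact hv.2 hx
        simp only [this]
    rw [ih hv.2] at h
    rw [Finset.card_insert_of_notMem hy, pow_succ]
    rw [show (1 / 2 : ℝ) ^ S.card * (1 / 2) * Fintype.card (SimpleGraph V) =
      (1 / 2) ^ S.card * Fintype.card (SimpleGraph V) / 2 by ring, ← h]
    refine Finset.sum_congr rfl fun G _ => ?_
    simp only [Finset.forall_mem_insert]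
    split_ifs <;> simp_all

/-- The graphs in which `u` and `v` have no common neighbour in `S`. -/
theorem card_no_common_neighbour_in {S : Finset V} {u v : V} (huv : u ≠ v) (hu : u ∉ S)
    (hv : v ∉ S) :
    ((Finset.univ.filter fun G : SimpleGraph V => ∀ x ∈ S, ¬ (G.Adj u x ∧ G.Adj x v)).card : ℝ) =
      (3 / 4) ^ S.card * Fintype.card (SimpleGraph V) := by
  rw [Finset.card_filter]
  push_cast
  induction S using Finset.induction_on with
  | empty => simp [Finset.card_univ]
  | insert y S hy ih =>
    rw [Finset.mem_insert, not_or] at hu hv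
    have hinv : ∀ a b : V, s(a, b) = s(u, y) ∨ s(a, b) = s(y, v) → ∀ G : SimpleGraph V,
        (if ∀ x ∈ S, ¬ ((toggle a b G).Adj u x ∧ (toggle a b G).Adj x v) then (1 : ℝ) else 0) =
        if ∀ x ∈ S, ¬ (G.Adj u x ∧ G.Adj x v) then 1 else 0 := by
      intro a b hab G
      have : (∀ x ∈ S, ¬ ((toggle a b G).Adj u x ∧ (toggle a b G).Adj x v)) ↔
          ∀ x ∈ S, ¬ (G.Adj u x ∧ G.Adj x v) := by
        refine forall₂_congr fun x hx => not_congr (and_congr (toggle_adj_of_ne (fun he => ?_) G)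
          (toggle_adj_of_ne (fun he => ?_) G)) <;>
        · rcases hab with hab | hab <;> rw [hab] at he <;>
          rcases Sym2.eq_iff.1 he with ⟨h1, h2⟩ | ⟨h1, h2⟩ <;> simp_all
      simp only [this]
    -- Two halvings: a quarter of the graphs that satisfy the condition on `S` contain both edges at
    -- `y` and are lost, leaving the factor `3/4`.
    have h := sum_adj_mul (Ne.symm hv.1)
      (h := fun G => (if G.Adj u y then 1 else 0) *
        if ∀ x ∈ S, ¬ (G.Adj u x ∧ G.Adj x v) then 1 else 0) fun G => by
        have hne : s(u, y) ≠ s(y, v) := fun he => by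
          rcases Sym2.eq_iff.1 he with ⟨h1, h2⟩ | ⟨h1, h2⟩ <;> simp_all
        simp only [hinv y v (Or.inr rfl), toggle_adj_of_ne hne]
    rw [sum_adj_mul hu.1 (hinv u y (Or.inl rfl)), ih hu.2 hv.2] at h
    have hsum : ∑ G : SimpleGraph V,
        (if ∀ x ∈ insert y S, ¬ (G.Adj u x ∧ G.Adj x v) then (1 : ℝ) else 0) =
        (∑ G : SimpleGraph V, if ∀ x ∈ S, ¬ (G.Adj u x ∧ G.Adj x v) then (1 : ℝ) else 0) -
        ∑ G : SimpleGraph V, (if G.Adj y v then 1 else 0) * ((if G.Adj u y then 1 else 0) *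
          if ∀ x ∈ S, ¬ (G.Adj u x ∧ G.Adj x v) then 1 else 0) := by
      rw [← Finset.sum_sub_distrib]
      refine Finset.sum_congr rfl fun G _ => ?_
      simp only [Finset.forall_mem_insert]
      split_ifs <;> simp_all
    rw [hsum, h, ih hu.2 hv.2, Finset.card_insert_of_notMem hy, pow_succ]
    ring

/-- Half of the weight stops at the head with factor `4/3`; the other half gains a factor `4/3` on
top of the bound `2` for the tail. The constant reproduces itself: `2/3 + 4/3 = 2`. The weight `h`
allows iteration over several `v` and restriction to a class of graphs. -/
theorem sum_pow_firstIndex_mul_le {xs : List V} (hxs : xs.Nodup) {v : V} (hv : v ∉ xs)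
    {h : SimpleGraph V → ℝ} (hpos : ∀ G, 0 ≤ h G)
    (hh : ∀ x ∈ xs, ∀ G, h (toggle x v G) = h G) :
    ∑ G : SimpleGraph V, (4 / 3) ^ (firstIndex G xs v + 1) * h G ≤ 2 * ∑ G, h G := by
  induction xs with
  | nil =>
    rw [Finset.mul_sum]
    refine Finset.sum_le_sum fun G _ => mul_le_mul_of_nonneg_right ?_ (hpos G)
    norm_num [firstIndex]
  | cons x xs ih =>
    rw [List.nodup_cons] at hxs
    rw [List.mem_cons, not_or] at hv
    rw [List.forall_mem_cons] at hh
    have ih' := ih hxs.2 hv.2 hh.2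
    have hinv : ∀ G, (4 / 3 : ℝ) ^ (firstIndex (toggle x v G) xs v + 1) * h (toggle x v G) =
        (4 / 3) ^ (firstIndex G xs v + 1) * h G := fun G => by
      rw [hh.1, firstIndex_toggle fun y hy he => ?_]
      rcases Sym2.eq_iff.1 he with ⟨rfl, _⟩ | ⟨rfl, _⟩
      · exact hxs.1 hy
      · exact hv.2 hy
    have h1 := sum_adj_mul (Ne.symm hv.1) hh.1
    have h2 := sum_not_adj_mul (Ne.symm hv.1)
      (h := fun G => (4 / 3 : ℝ) ^ (firstIndex G xs v + 1) * h G) hinv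
    have hsum : ∑ G : SimpleGraph V, (4 / 3) ^ (firstIndex G (x :: xs) v + 1) * h G =
        4 / 3 * ∑ G : SimpleGraph V, (if G.Adj x v then 1 else 0) * h G +
        4 / 3 * ∑ G : SimpleGraph V, (if G.Adj x v then 0 else 1) *
          ((4 / 3) ^ (firstIndex G xs v + 1) * h G) := by
      rw [Finset.mul_sum, Finset.mul_sum, ← Finset.sum_add_distrib]
      refine Finset.sum_congr rfl fun G _ => ?_
      by_cases hG : G.Adj x v
      · simp [firstIndex, List.findIdx_cons, hG]
      · simp [firstIndex, List.findIdx_cons, hG, pow_succ]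
        ring
    rw [hsum, h1, h2]
    linarith

/-- Since `xs` and `Y` are disjoint, distinct `v` in `Y` involve disjoint sets of pairs, and the
factors for the other nodes can be absorbed into the weight. -/
theorem sum_prod_pow_firstIndex_mul_le {xs : List V} (hxs : xs.Nodup) {Y : Finset V}
    (hY : ∀ x ∈ xs, x ∉ Y) {h : SimpleGraph V → ℝ} (hpos : ∀ G, 0 ≤ h G)
    (hh : ∀ x ∈ xs, ∀ v ∈ Y, ∀ G, h (toggle x v G) = h G) :
    ∑ G : SimpleGraph V, (∏ v ∈ Y, (4 / 3 : ℝ) ^ (firstIndex G xs v + 1)) * h G ≤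
      2 ^ Y.card * ∑ G, h G := by
  induction Y using Finset.induction_on with
  | empty => simp
  | insert y Y hy ih =>
    simp only [Finset.mem_insert, not_or] at hY hh
    have ih' := ih (fun x hx => (hY x hx).2) fun x hx v hv => hh x hx v (Or.inr hv)
    have h1 := sum_pow_firstIndex_mul_le hxs (v := y) (fun hy => (hY y hy).1 rfl)
      (h := fun G => (∏ v ∈ Y, (4 / 3 : ℝ) ^ (firstIndex G xs v + 1)) * h G)
      (fun G => mul_nonneg (Finset.prod_nonneg fun _ _ => by positivity) (hpos G))
      fun x hx G => by
        rw [hh x hx y (Or.inl rfl)]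
        congr 1
        refine Finset.prod_congr rfl fun v hv => ?_
        rw [firstIndex_toggle fun x' hx' he => ?_]
        rcases Sym2.eq_iff.1 he with ⟨_, rfl⟩ | ⟨_, rfl⟩
        · exact hy hv
        · exact (hY _ hx).2 hv
    rw [Finset.card_insert_of_notMem hy, pow_succ]
    calc _ = ∑ G : SimpleGraph V, (4 / 3 : ℝ) ^ (firstIndex G xs y + 1) *
          ((∏ v ∈ Y, (4 / 3 : ℝ) ^ (firstIndex G xs v + 1)) * h G) := by
          refine Finset.sum_congr rfl fun G _ => ?_
          rw [Finset.prod_insert hy, mul_assoc]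
      _ ≤ 2 * (2 ^ Y.card * ∑ G, h G) := h1.trans (by linarith)
      _ = _ := by ring

/-- The neighbours of `w` in the order of the list `L`. -/
noncomputable def orderedNeighbours (L : List V) (G : SimpleGraph V) (w : V) : List V :=
  L.filter fun x => decide (G.Adj w x)

/-- The place of the node over which `w` reaches `v`, among the neighbours of `w`. -/
noncomputable def relayIndex (L : List V) (G : SimpleGraph V) (w v : V) : ℕ :=
  if v = w ∨ G.Adj w v then 0 else firstIndex G (orderedNeighbours L G w) v

/-- The list searched for a relay depends on the graph. Grouping the graphs by the neighbour list of
`w` fixes it, while the pairs between neighbours and non-neighbours of `w` stay free. -/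
theorem sum_pow_relayIndex_le {L : List V} (hL : L.Nodup) (hmem : ∀ v, v ∈ L) (w : V) :
    ∑ G : SimpleGraph V, (4 / 3 : ℝ) ^ (∑ v, (relayIndex L G w v + 1)) ≤
      2 ^ Fintype.card V * Fintype.card (SimpleGraph V) := by
  have hmaps : ∀ G ∈ (Finset.univ : Finset (SimpleGraph V)),
      orderedNeighbours L G w ∈ Finset.univ.image fun G => orderedNeighbours L G w :=
    fun G _ => Finset.mem_image_of_mem (fun G => orderedNeighbours L G w) (Finset.mem_univ G)
  rw [← Finset.sum_fiberwise_of_maps_to hmaps, ← Finset.card_univ (α := SimpleGraph V),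
    Finset.card_eq_sum_card_fiberwise hmaps]
  push_cast
  rw [Finset.mul_sum]
  refine Finset.sum_le_sum fun xs hxs => ?_
  obtain ⟨G₀, -, hG₀⟩ := Finset.mem_image.1 hxs
  have hnodup : xs.Nodup := hG₀ ▸ hL.filter _
  have hw : w ∉ xs := by
    rw [← hG₀]
    simp [orderedNeighbours]
  -- `Y` consists of the nodes that need a relay.
  set Y : Finset V := Finset.univ.filter fun v => ¬ (v = w ∨ v ∈ xs) with hYdef
  have hfib : ∀ G, orderedNeighbours L G w = xs → ∀ v, G.Adj w v ↔ v ∈ xs := fun G hG v => by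
    rw [← hG]
    simp [orderedNeighbours, hmem]
  have key := sum_prod_pow_firstIndex_mul_le hnodup (Y := Y) (fun x hx => by simp [hYdef, hx])
    (h := fun G => if orderedNeighbours L G w = xs then 1 else 0)
    (fun G => by positivity) fun x hx v hv G => by
      have : orderedNeighbours L (toggle x v G) w = orderedNeighbours L G w := by
        unfold orderedNeighbours
        refine List.filter_congr fun y _ => ?_
        rw [toggle_adj_of_ne fun he => ?_]
        rcases Sym2.eq_iff.1 he with ⟨rfl, _⟩ | ⟨rfl, _⟩
        · exact hw hx
        · simp [hYdef] at hv
      simp only [this]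
  have hcard : (∑ G : SimpleGraph V, if orderedNeighbours L G w = xs then (1 : ℝ) else 0) =
      ((Finset.univ.filter fun G => orderedNeighbours L G w = xs).card : ℝ) := by
    rw [Finset.card_filter]
    push_cast
    rfl
  have hY : Y.card + (Yᶜ).card = Fintype.card V := Finset.card_add_card_compl Y
  calc ∑ G ∈ Finset.univ.filter (fun G => orderedNeighbours L G w = xs),
        (4 / 3 : ℝ) ^ (∑ v, (relayIndex L G w v + 1))
      = (4 / 3) ^ (Yᶜ).card * ∑ G : SimpleGraph V,
          (∏ v ∈ Y, (4 / 3 : ℝ) ^ (firstIndex G xs v + 1)) *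
            (if orderedNeighbours L G w = xs then 1 else 0) := by
        rw [Finset.sum_filter, Finset.mul_sum]
        refine Finset.sum_congr rfl fun G _ => ?_
        split_ifs with hG
        · rw [← Finset.prod_pow_eq_pow_sum, ← Finset.prod_mul_prod_compl Y, mul_one, mul_comm]
          congr 1
          · rw [← Finset.prod_const]
            refine Finset.prod_congr rfl fun v hv => ?_
            have : v = w ∨ G.Adj w v := by
              rw [hfib G hG]
              by_contra hcon
              exact (Finset.mem_compl.1 hv) (by simpa [hYdef] using hcon)
            simp [relayIndex, this]
          · refine Finset.prod_congr rfl fun v hv => ?_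
            have : ¬ (v = w ∨ G.Adj w v) := by
              rw [hfib G hG]
              simpa [hYdef] using hv
            rw [relayIndex, if_neg this, hG]
        · simp
    _ ≤ (4 / 3) ^ (Yᶜ).card * (2 ^ Y.card *
          ((Finset.univ.filter fun G => orderedNeighbours L G w = xs).card : ℝ)) := by
        rw [← hcard]
        exact mul_le_mul_of_nonneg_left key (by positivity)
    -- A node that needs no relay contributes `4/3`, rounded up to `2` so that the bound no longer
    -- depends on `xs`.
    _ ≤ 2 ^ (Yᶜ).card * (2 ^ Y.card *
          ((Finset.univ.filter fun G => orderedNeighbours L G w = xs).card : ℝ)) := by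
        refine mul_le_mul_of_nonneg_right (pow_le_pow_left₀ (by norm_num) (by norm_num) _)
          (by positivity)
    _ = _ := by rw [← hY, pow_add]; ring

/-- Few graphs need many bits for the relays of `w`. -/
theorem card_relayIndex_ge_le {L : List V} (hL : L.Nodup) (hmem : ∀ v, v ∈ L) (w : V) (t : ℕ) :
    ((Finset.univ.filter fun G : SimpleGraph V =>
      t ≤ ∑ v, (relayIndex L G w v + 1)).card : ℝ) * (4 / 3) ^ t ≤
      2 ^ Fintype.card V * Fintype.card (SimpleGraph V) := by
  refine le_trans ?_ (sum_pow_relayIndex_le hL hmem w)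
  -- Markov's inequality for the exponential moment.
  rw [← nsmul_eq_mul, ← Finset.sum_const, Finset.sum_filter]
  refine Finset.sum_le_sum fun G _ => ?_
  split_ifs with hG
  · exact pow_le_pow_right₀ (by norm_num) hG
  · positivity

end Counting

/-! ### Graphs and their edge strings -/

/-- The status of the pair `{u, v}` in the graph on `n` nodes with edge string `s`. -/
def adjBit (n : ℕ) (s : List Bool) (u v : ℕ) : Bool :=
  s.getD ((labelPairs n).idxOf (min u v, max u v)) false

theorem primrec_adjBit {α : Type*} [Primcodable α] {f : α → ℕ} {g : α → List Bool} {u v : α → ℕ}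
    (hf : Primrec f) (hg : Primrec g) (hu : Primrec u) (hv : Primrec v) :
    Primrec fun a => adjBit (f a) (g a) (u a) (v a) :=
  (Primrec.list_getD false).comp hg (primrec_idxOf.comp
    ((Primrec.nat_min.comp hu hv).pair (Primrec.nat_max.comp hu hv)) (primrec_labelPairs.comp hf))

open Classical in
/-- Adjacency of `G` as a Boolean function of natural numbers. -/
noncomputable def natAdj {n : ℕ} (G : SimpleGraph (Fin n)) (u v : ℕ) : Bool :=
  decide (∃ (hu : u < n) (hv : v < n), G.Adj ⟨u, hu⟩ ⟨v, hv⟩)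

open Classical in
@[simp]
theorem natAdj_val {n : ℕ} (G : SimpleGraph (Fin n)) (u v : Fin n) :
    natAdj G u v = decide (G.Adj u v) := by
  simp [natAdj]

theorem natAdj_comm {n : ℕ} (G : SimpleGraph (Fin n)) (u v : ℕ) : natAdj G u v = natAdj G v u := by
  simp only [natAdj, decide_eq_decide]
  exact ⟨fun ⟨hu, hv, h⟩ => ⟨hv, hu, h.symm⟩, fun ⟨hu, hv, h⟩ => ⟨hv, hu, h.symm⟩⟩

theorem edgeString_eq_map {n : ℕ} (G : SimpleGraph (Fin n)) :
    edgeString G = (labelPairs n).map fun e => natAdj G e.1 e.2 := by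
  rw [edgeString, labelPairs, List.map_flatMap, ← List.map_coe_finRange_eq_range,
    List.flatMap_map]
  congr 1
  funext u
  rw [List.filter_map, List.map_map, List.map_map]
  simp [Function.comp_def]

theorem length_edgeString {n : ℕ} (G : SimpleGraph (Fin n)) :
    (edgeString G).length = (labelPairs n).length := by
  rw [edgeString_eq_map, List.length_map]

theorem adjBit_edgeString {n : ℕ} (G : SimpleGraph (Fin n)) :
    adjBit n (edgeString G) = natAdj G := by
  funext u v
  wlog huv : u ≤ v generalizing u v
  · rw [natAdj_comm, ← this v u (le_of_not_ge huv), adjBit, adjBit, min_comm, max_comm]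
  rw [adjBit, min_eq_left huv, max_eq_right huv]
  by_cases hmem : (u, v) ∈ labelPairs n
  · have hlt := List.idxOf_lt_length_iff.2 hmem
    rw [List.getD_eq_getElem _ _ (by rwa [length_edgeString])]
    simp only [edgeString_eq_map, List.getElem_map, List.getElem_idxOf]
  -- On the diagonal and out of range both sides are `false`, so no bounds on `u` and `v` are
  -- needed.
  · rw [List.getD_eq_default _ _ (by
      rw [length_edgeString, List.idxOf_eq_length hmem])]
    rw [mem_labelPairs] at hmem
    symm
    simp only [natAdj, decide_eq_false_iff_not]
    rintro ⟨hu, hv, h⟩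
    exact hmem ⟨lt_of_le_of_ne huv fun he => h.ne (Fin.ext he), hv⟩

theorem edgeString_injective (n : ℕ) :
    Function.Injective (edgeString : SimpleGraph (Fin n) → List Bool) := by
  intro G H h
  have h2 : natAdj G = natAdj H := by rw [← adjBit_edgeString, h, adjBit_edgeString]
  ext u v
  simpa using congrFun (congrFun h2 u) v

/-- Lets bad strings be counted as bad graphs. -/
theorem exists_edgeString_eq {n : ℕ} {s : List Bool} (hs : s.length = (labelPairs n).length) :
    ∃ G : SimpleGraph (Fin n), edgeString G = s := by
  let G : SimpleGraph (Fin n) :=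
    { Adj := fun u v => adjBit n s u v = true
      symm := ⟨fun u v h => by rwa [adjBit, min_comm, max_comm] at h⟩
      loopless := ⟨fun u h => by
        have hmem : ((u : ℕ), (u : ℕ)) ∉ labelPairs n := by simp [mem_labelPairs]
        rw [adjBit, min_self, max_self, List.idxOf_eq_length hmem, ← hs,
          List.getD_eq_default _ _ le_rfl] at h
        cases h⟩ }
  have hG : ∀ (u v : ℕ) (hu : u < n) (hv : v < n), natAdj G u v = adjBit n s u v := by
    intro u v hu hv
    simp [natAdj, hu, hv, G]
  refine ⟨G, ?_⟩
  rw [edgeString_eq_map]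
  refine List.ext_getElem (by simp [hs]) fun i h1 h2 => ?_
  rw [List.length_map] at h1
  have hmem := mem_labelPairs.1 (List.getElem_mem h1)
  rw [List.getElem_map, hG _ _ (hmem.1.trans hmem.2) hmem.2, adjBit, min_eq_left hmem.1.le,
    max_eq_right hmem.1.le, (nodup_labelPairs n).idxOf_getElem, List.getD_eq_getElem _ _ h2]

open Classical in
theorem card_simpleGraph_le (n : ℕ) :
    Fintype.card (SimpleGraph (Fin n)) ≤ 2 ^ (labelPairs n).length := by
  rw [← length_boolLists, ← List.toFinset_card_of_nodup (nodup_boolLists _), ← Finset.card_univ]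
  refine Finset.card_le_card_of_injOn edgeString (fun G _ => ?_) (edgeString_injective n).injOn
  simpa [mem_boolLists] using length_edgeString G

open Classical in
theorem length_badStrings_le (bad : ℕ → List Bool → Bool) (n : ℕ) :
    (badStrings bad n).length ≤
      (Finset.univ.filter fun G : SimpleGraph (Fin n) => bad n (edgeString G) = true).card := by
  rw [badStrings, ← List.toFinset_card_of_nodup ((nodup_boolLists _).filter _)]
  refine (Finset.card_le_card fun s hs => ?_).trans (Finset.card_image_le (f := edgeString))
  rw [List.mem_toFinset, List.mem_filter, mem_boolLists] at hs
  obtain ⟨G, rfl⟩ := exists_edgeString_eq hs.1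
  exact Finset.mem_image_of_mem _ (by simpa using hs.2)

open Classical in
/-- A decidable property of a proportion `ε(n) = o(n ^ (-q))` of all graphs is not shared by any
`c log n`-random graph on sufficiently many nodes, where `c ≤ q`. -/
theorem eventually_not_bad_of_isRandomGraph {U : Machine} (hU : U.IsUniversal)
    {bad : ℕ → List Bool → Bool} (hbad : Primrec₂ bad) {c : ℝ} {q : ℕ} (hc : c ≤ q) {ε : ℕ → ℝ}
    (hε : Tendsto (fun n : ℕ => (n : ℝ) ^ q * ε n) atTop (𝓝 0))
    (hcard : ∀ᶠ n : ℕ in atTop, ((Finset.univ.filter fun G : SimpleGraph (Fin n) =>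
      bad n (edgeString G) = true).card : ℝ) ≤ ε n * Fintype.card (SimpleGraph (Fin n))) :
    ∀ᶠ n : ℕ in atTop, ∀ (a : ℕ) (G : SimpleGraph (Fin n)),
      IsRandomGraph U a (c * Real.logb 2 n) G → bad n (edgeString G) = false := by
  obtain ⟨k, hk⟩ := condComplexity_le_of_bad hU hbad
  -- The factor `2 ^ k` pays for the additive constant of the complexity bound, one more `2` for
  -- rounding the number of bad strings up to a power of two.
  filter_upwards [hcard, hε.eventually_lt_const (show (0 : ℝ) < 1 / 2 ^ (k + 1) by positivity),
    eventually_ge_atTop 1] with n hn1 hn2 hn a G hG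
  by_contra hcon
  rw [Bool.not_eq_false] at hcon
  have hmem : edgeString G ∈ badStrings bad n :=
    List.mem_filter.2 ⟨mem_boolLists.2 (length_edgeString G), hcon⟩
  set D := (badStrings bad n).length with hD
  have hDpos : 0 < D := List.length_pos_of_mem hmem
  obtain ⟨l, hl1, hl2⟩ : ∃ l, D ≤ 2 ^ l ∧ 2 ^ l ≤ 2 * D := by
    refine ⟨Nat.log 2 D + 1, (Nat.lt_pow_succ_log_self one_lt_two D).le, ?_⟩
    rw [pow_succ, mul_comm]
    exact Nat.mul_le_mul_left 2 (Nat.pow_log_le_self 2 hDpos.ne')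
  have hC := hk n a l _ hmem hl1
  have hnpos : (0 : ℝ) < n := by exact_mod_cast hn
  have hlog : 0 ≤ Real.logb 2 (n : ℝ) := Real.logb_nonneg one_lt_two (by exact_mod_cast hn)
  have h1 : ((labelPairs n).length : ℝ) ≤ (l : ℝ) + k + Real.logb 2 n * q := by
    have h2 : (condComplexity U (Encodable.encode (edgeString G)) (Encodable.encode (n, a)) : ℝ) ≤
        l + k := by exact_mod_cast hC
    have h3 := mul_le_mul_of_nonneg_right hc hlog
    unfold IsRandomGraph at hG
    rw [length_labelPairs]
    linarith
  have h2 : (2 : ℝ) ^ (labelPairs n).length ≤ 2 ^ l * 2 ^ k * (n : ℝ) ^ q := by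
    have h3 := Real.rpow_le_rpow_of_exponent_le (one_le_two (α := ℝ)) h1
    rwa [Real.rpow_add two_pos, Real.rpow_add two_pos, Real.rpow_natCast, Real.rpow_natCast,
      Real.rpow_natCast, Real.rpow_mul zero_le_two, Real.rpow_logb two_pos (by norm_num) hnpos,
      Real.rpow_natCast] at h3
  have hDε : (D : ℝ) ≤ ε n * Fintype.card (SimpleGraph (Fin n)) :=
    le_trans (by exact_mod_cast length_badStrings_le bad n) hn1
  have hεpos : 0 < ε n := by
    have h3 : (0 : ℝ) < ε n * Fintype.card (SimpleGraph (Fin n)) :=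
      lt_of_lt_of_le (by exact_mod_cast hDpos) hDε
    exact pos_of_mul_pos_left h3 (by positivity)
  have h3 : (2 : ℝ) ^ l ≤ 2 * (ε n * 2 ^ (labelPairs n).length) := by
    calc (2 : ℝ) ^ l ≤ 2 * D := by exact_mod_cast hl2
      _ ≤ 2 * (ε n * Fintype.card (SimpleGraph (Fin n))) := by linarith
      _ ≤ _ := by
        have := card_simpleGraph_le n
        gcongr
        exact_mod_cast this
  -- The number of strings is bounded by itself times a factor below one.
  have h4 : (2 : ℝ) ^ (labelPairs n).length ≤
      2 ^ (labelPairs n).length * (2 ^ (k + 1) * ((n : ℝ) ^ q * ε n)) := by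
    calc (2 : ℝ) ^ (labelPairs n).length ≤ 2 ^ l * (2 ^ k * (n : ℝ) ^ q) := by rwa [← mul_assoc]
      _ ≤ 2 * (ε n * 2 ^ (labelPairs n).length) * (2 ^ k * (n : ℝ) ^ q) := by gcongr
      _ = _ := by ring
  have h5 : 2 ^ (k + 1) * ((n : ℝ) ^ q * ε n) < 1 := by
    rwa [lt_div_iff₀ (by positivity), mul_comm] at hn2
  have h6 : (0 : ℝ) < 2 ^ (labelPairs n).length := by positivity
  nlinarith

/-! ### The local routing functions -/

/-- The prefix code `i ↦ 0^i 1`. -/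
def unaryCode (l : List ℕ) : List Bool := l.flatMap fun i => List.replicate i false ++ [true]

/-- Inverts `unaryCode`. -/
def unaryDecode (p : List Bool) : List ℕ :=
  List.rec [] (fun b _ r => bif b then 0 :: r else (r.headI + 1) :: r.tail) p

theorem unaryDecode_unaryCode (l : List ℕ) : unaryDecode (unaryCode l) = l := by
  induction l with
  | nil => rfl
  | cons i l ih =>
    rw [unaryCode, List.flatMap_cons, ← unaryCode]
    induction i with
    | zero => exact congrArg (List.cons 0) ih
    | succ i ih2 =>
      rw [List.replicate_succ, List.cons_append, List.cons_append]
      change ((unaryDecode _).headI + 1) :: (unaryDecode _).tail = _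
      rw [ih2]
      rfl

theorem length_unaryCode (l : List ℕ) : (unaryCode l).length = (l.map (· + 1)).sum := by
  simp [unaryCode, List.length_flatMap]

theorem primrec_unaryCode : Primrec unaryCode := by
  refine Primrec.list_flatMap Primrec.id ?_
  exact Primrec.list_append.comp (primrec_replicate Primrec.snd false) (Primrec.const [true])

theorem primrec_unaryDecode : Primrec unaryDecode := by
  have h : Primrec₂ fun (_ : List Bool) (x : Bool × List Bool × List ℕ) =>
      bif x.1 then 0 :: x.2.2 else (x.2.2.headI + 1) :: x.2.2.tail := by
    have hr : Primrec fun x : List Bool × Bool × List Bool × List ℕ => x.2.2.2 :=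
      Primrec.snd.comp (Primrec.snd.comp Primrec.snd)
    exact Primrec.cond (Primrec.fst.comp Primrec.snd)
      (Primrec.list_cons.comp (Primrec.const 0) hr)
      (Primrec.list_cons.comp (Primrec.succ.comp (Primrec.list_headI.comp hr))
        (Primrec.list_tail.comp hr))
  exact Primrec.list_rec Primrec.id (Primrec.const ([] : List ℕ)) h

/-- Forwards directly if the destination is a neighbour; otherwise uses the neighbour whose place
among all neighbours is read off from the program, and the first one if the program is empty. -/
def routeStep (p : List Bool) (nbrs : List ℕ) (v : ℕ) : ℕ :=
  bif nbrs.any (fun x => decide (x = v)) then v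
  else nbrs.getD ((unaryDecode p).getD (v - 1) 0) 0

theorem primrec_routeStep : Primrec₂ fun (p : List Bool) (y : ℕ) =>
    routeStep p (Denumerable.ofNat (ℕ × List ℕ × ℕ) y).2.1
      (Denumerable.ofNat (ℕ × List ℕ × ℕ) y).2.2 := by
  have hy : Primrec fun x : List Bool × ℕ => (Denumerable.ofNat (ℕ × List ℕ × ℕ) x.2).2 :=
    Primrec.snd.comp ((Primrec.ofNat (ℕ × List ℕ × ℕ)).comp Primrec.snd)
  have hn := Primrec.fst.comp hy
  have hv := Primrec.snd.comp hy
  refine Primrec.cond (primrec_any hn ?_) hv ((Primrec.list_getD 0).comp hn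
    ((Primrec.list_getD 0).comp (primrec_unaryDecode.comp Primrec.fst)
      (Primrec.nat_sub.comp hv (Primrec.const 1))))
  exact (PrimrecRel.comp Primrec.eq Primrec.snd (hv.comp Primrec.fst)).decide

/-- For every node of the graph on `n` nodes, the place of its relay among the neighbours of
`w`. -/
def relayList (n : ℕ) (A : ℕ → ℕ → Bool) (w : ℕ) : List ℕ :=
  (List.range n).map fun v => bif decide (v = w) || A w v then 0
    else ((List.range n).filter (A w)).findIdx fun x => A x v

/-- Links the computable form, needed for decidability and for the stored program, to the form used
in counting. -/
theorem relayList_natAdj {n : ℕ} (G : SimpleGraph (Fin n)) (w : Fin n) :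
    relayList n (natAdj G) w = (List.finRange n).map (relayIndex (List.finRange n) G w) := by
  rw [relayList, ← List.map_coe_finRange_eq_range, List.map_map]
  refine List.map_congr_left fun v _ => ?_
  rw [List.filter_map]
  simp only [Function.comp_def, List.findIdx_map, natAdj_val, relayIndex, firstIndex,
    orderedNeighbours, Fin.val_inj]
  by_cases h : v = w ∨ G.Adj w v
  · rw [if_pos h]
    rcases h with h | h <;> simp [h]
  · rw [if_neg h]
    rw [not_or] at h
    simp [h.1, h.2]

theorem length_unaryCode_relayList {n : ℕ} (G : SimpleGraph (Fin n)) (w : Fin n) :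
    (unaryCode (relayList n (natAdj G) w)).length =
      ∑ v, (relayIndex (List.finRange n) G w v + 1) := by
  rw [length_unaryCode, relayList_natAdj, List.map_map, ← List.ofFn_eq_map, List.sum_ofFn]
  rfl

/-! ### Three rare properties -/

/-- Some node `u ≥ d log n` has no neighbour below `d log n`. -/
def hasUncovered (d n : ℕ) (s : List Bool) : Bool :=
  (List.range n).any fun u => decide (d * Nat.log 2 n ≤ u) &&
    (List.range (d * Nat.log 2 n)).all fun x => !adjBit n s x u

/-- Some two nodes have no common neighbour. -/
def hasFarPair (n : ℕ) (s : List Bool) : Bool :=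
  (List.range n).any fun u => (List.range n).any fun v => decide (u < v) &&
    (List.range n).all fun x => !(adjBit n s u x && adjBit n s x v)

/-- The relays of some node take more than `3n - k` bits. -/
def hasLongCode (k n : ℕ) (s : List Bool) : Bool :=
  (List.range n).any fun w =>
    decide (3 * n < k + (unaryCode (relayList n (adjBit n s) w)).length)

theorem primrec_hasUncovered (d : ℕ) : Primrec₂ (hasUncovered d) := by
  have hm {α : Type} [Primcodable α] {f : α → ℕ} (hf : Primrec f) :
      Primrec fun a => d * Nat.log 2 (f a) :=
    Primrec.nat_mul.comp (Primrec.const d) (primrec_log_two.comp hf)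
  refine primrec_any (Primrec.list_range.comp Primrec.fst) ?_
  have hn : Primrec fun x : (ℕ × List Bool) × ℕ => x.1.1 := Primrec.fst.comp Primrec.fst
  refine Primrec.and.comp (PrimrecRel.comp Primrec.nat_le (hm hn) Primrec.snd).decide
    (primrec_all (Primrec.list_range.comp (hm hn)) ?_)
  exact Primrec.not.comp (primrec_adjBit (hn.comp Primrec.fst)
    (Primrec.snd.comp (Primrec.fst.comp Primrec.fst)) Primrec.snd (Primrec.snd.comp Primrec.fst))

theorem primrec_hasFarPair : Primrec₂ hasFarPair := by
  refine primrec_any (Primrec.list_range.comp Primrec.fst) ?_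
  refine primrec_any (Primrec.list_range.comp (Primrec.fst.comp Primrec.fst)) ?_
  refine Primrec.and.comp
    (PrimrecRel.comp Primrec.nat_lt (Primrec.snd.comp Primrec.fst) Primrec.snd).decide
    (primrec_all (Primrec.list_range.comp
      (Primrec.fst.comp (Primrec.fst.comp Primrec.fst))) ?_)
  have hz : Primrec fun x : (((ℕ × List Bool) × ℕ) × ℕ) × ℕ => x.1.1.1 :=
    Primrec.fst.comp (Primrec.fst.comp Primrec.fst)
  exact Primrec.not.comp (Primrec.and.comp
    (primrec_adjBit (Primrec.fst.comp hz) (Primrec.snd.comp hz)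
      (Primrec.snd.comp (Primrec.fst.comp Primrec.fst)) Primrec.snd)
    (primrec_adjBit (Primrec.fst.comp hz) (Primrec.snd.comp hz) Primrec.snd
      (Primrec.snd.comp Primrec.fst)))

theorem primrec_relayList :
    Primrec fun x : (ℕ × List Bool) × ℕ => relayList x.1.1 (adjBit x.1.1 x.1.2) x.2 := by
  have hn : Primrec fun x : (ℕ × List Bool) × ℕ => x.1.1 := Primrec.fst.comp Primrec.fst
  have hs : Primrec fun x : (ℕ × List Bool) × ℕ => x.1.2 := Primrec.snd.comp Primrec.fst
  refine Primrec.list_map (Primrec.list_range.comp hn) ?_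
  have hw : Primrec fun x : ((ℕ × List Bool) × ℕ) × ℕ => x.1.2 := Primrec.snd.comp Primrec.fst
  have hf := hn.comp (Primrec.fst (α := (ℕ × List Bool) × ℕ) (β := ℕ))
  have hg := hs.comp (Primrec.fst (α := (ℕ × List Bool) × ℕ) (β := ℕ))
  refine Primrec.cond (Primrec.or.comp (PrimrecRel.comp Primrec.eq Primrec.snd hw).decide
    (primrec_adjBit hf hg hw Primrec.snd)) (Primrec.const 0)
    (Primrec.list_findIdx (primrec_filter (Primrec.list_range.comp hf) ?_) ?_)
  · exact primrec_adjBit (hf.comp Primrec.fst) (hg.comp Primrec.fst) (hw.comp Primrec.fst)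
      Primrec.snd
  · exact primrec_adjBit (hf.comp Primrec.fst) (hg.comp Primrec.fst) Primrec.snd
      (Primrec.snd.comp Primrec.fst)

theorem primrec_hasLongCode (k : ℕ) : Primrec₂ (hasLongCode k) := by
  refine primrec_any (Primrec.list_range.comp Primrec.fst) ?_
  refine (PrimrecRel.comp Primrec.nat_lt ?_ ?_).decide
  · exact Primrec.nat_mul.comp (Primrec.const 3) (Primrec.fst.comp Primrec.fst)
  · exact Primrec.nat_add.comp (Primrec.const k)
      (Primrec.list_length.comp (primrec_unaryCode.comp primrec_relayList))

/-! ### The rare properties in terms of graphs -/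

open Classical in
theorem hasUncovered_edgeString {d n : ℕ} {G : SimpleGraph (Fin n)} :
    hasUncovered d n (edgeString G) = true ↔ ∃ u : Fin n, d * Nat.log 2 n ≤ u ∧
      ∀ x : Fin n, (x : ℕ) < d * Nat.log 2 n → ¬ G.Adj x u := by
  simp only [hasUncovered, adjBit_edgeString, List.any_eq_true, List.mem_range, List.all_eq_true,
    Bool.and_eq_true, decide_eq_true_eq, Bool.not_eq_true']
  constructor
  · rintro ⟨u, hu, hm, h⟩
    exact ⟨⟨u, hu⟩, hm, fun x hx => by simpa using (natAdj_val G x ⟨u, hu⟩).symm.trans (h x hx)⟩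
  · rintro ⟨u, hm, h⟩
    refine ⟨u, u.2, hm, fun x hx => ?_⟩
    have h2 := h ⟨x, hx.trans_le (hm.trans u.2.le)⟩ hx
    simpa using (natAdj_val G ⟨x, hx.trans_le (hm.trans u.2.le)⟩ u).trans (decide_eq_false h2)

theorem hasFarPair_edgeString {n : ℕ} {G : SimpleGraph (Fin n)} :
    hasFarPair n (edgeString G) = true ↔ ∃ u v : Fin n, u < v ∧
      ∀ x : Fin n, ¬ (G.Adj u x ∧ G.Adj x v) := by
  simp only [hasFarPair, adjBit_edgeString, List.any_eq_true, List.mem_range, List.all_eq_true,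
    Bool.and_eq_true, decide_eq_true_eq, Bool.not_eq_true']
  constructor
  · rintro ⟨u, hu, v, hv, huv, h⟩
    refine ⟨⟨u, hu⟩, ⟨v, hv⟩, huv, fun x => ?_⟩
    have h2 := h x x.2
    rw [natAdj_val G ⟨u, hu⟩ x, natAdj_val G x ⟨v, hv⟩] at h2
    simpa using h2
  · rintro ⟨u, v, huv, h⟩
    refine ⟨u, u.2, v, v.2, huv, fun x hx => ?_⟩
    rw [natAdj_val G u ⟨x, hx⟩, natAdj_val G ⟨x, hx⟩ v]
    simpa using h ⟨x, hx⟩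

theorem hasLongCode_edgeString {k n : ℕ} {G : SimpleGraph (Fin n)} :
    hasLongCode k n (edgeString G) = true ↔ ∃ w : Fin n,
      3 * n < k + ∑ v, (relayIndex (List.finRange n) G w v + 1) := by
  simp only [hasLongCode, adjBit_edgeString, List.any_eq_true, List.mem_range, decide_eq_true_eq]
  constructor
  · rintro ⟨w, hw, h⟩
    exact ⟨⟨w, hw⟩, by rwa [← length_unaryCode_relayList]⟩
  · rintro ⟨w, h⟩
    exact ⟨w, w.2, by rwa [length_unaryCode_relayList]⟩

/-- The union bound, with counts in place of probabilities. -/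
theorem card_filter_le_of_exists {α ι : Type*} [Fintype α] [Fintype ι] {p : α → Prop}
    [DecidablePred p] {r : ι → α → Prop} [∀ i, DecidablePred (r i)] (h : ∀ a, p a → ∃ i, r i a) {b : ℝ}
    (hb : ∀ i, ((Finset.univ.filter (r i)).card : ℝ) ≤ b) :
    ((Finset.univ.filter p).card : ℝ) ≤ Fintype.card ι * b := by
  classical
  have h1 : (Finset.univ.filter p) ⊆ Finset.univ.biUnion fun i => Finset.univ.filter (r i) := by
    intro a ha
    simpa using h a (by simpa using ha)
  calc ((Finset.univ.filter p).card : ℝ)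
      ≤ ∑ i : ι, ((Finset.univ.filter (r i)).card : ℝ) := by
        exact_mod_cast (Finset.card_le_card h1).trans Finset.card_biUnion_le
    _ ≤ ∑ _i : ι, b := Finset.sum_le_sum fun i _ => hb i
    _ = _ := by simp

theorem tendsto_pow_mul_pow_mul_geometric (q j : ℕ) (C : ℝ) {r : ℝ} (h0 : 0 ≤ r) (h1 : r < 1) :
    Tendsto (fun n : ℕ => (n : ℝ) ^ q * ((n : ℝ) ^ j * (C * r ^ n))) atTop (𝓝 0) := by
  have h := (tendsto_pow_const_mul_const_pow_of_lt_one (q + j) h0 h1).const_mul C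
  rw [mul_zero] at h
  refine h.congr fun n => ?_
  rw [pow_add]
  ring

/-! ### Random graphs have none of the rare properties -/

open Classical in
-- A fixed node fails in a fraction at most `(2 / n) ^ (q + 2)` of the graphs. Of the exponent, `q`
-- pays for the deficiency and one for the union over nodes; the last makes the product tend to
-- zero.
theorem eventually_exists_neighbour_lt {U : Machine} (hU : U.IsUniversal) {c : ℝ} {q : ℕ}
    (hc : c ≤ q) : ∀ᶠ n : ℕ in atTop,
    ∀ (a : ℕ) (G : SimpleGraph (Fin n)), IsRandomGraph U a (c * Real.logb 2 n) G →
      ∀ u : Fin n, (q + 2) * Nat.log 2 n ≤ u →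
        ∃ x : Fin n, (x : ℕ) < (q + 2) * Nat.log 2 n ∧ G.Adj x u := by
  have key := eventually_not_bad_of_isRandomGraph hU (primrec_hasUncovered (q + 2)) hc
    (ε := fun n => n * (2 / n) ^ (q + 2)) ?_ ?_
  · filter_upwards [key] with n hn a G hG u hu
    by_contra! hcon
    exact Bool.false_ne_true ((hn a G hG).symm.trans (hasUncovered_edgeString.2 ⟨u, hu, hcon⟩))
  · have h := tendsto_const_div_atTop_nhds_zero_nat ((2 : ℝ) ^ (q + 2))
    refine h.congr' ?_
    filter_upwards [eventually_gt_atTop 0] with n hn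
    have hn' : (n : ℝ) ≠ 0 := by positivity
    rw [div_pow]
    field_simp
    ring
  · filter_upwards [eventually_gt_atTop 0] with n hn
    have hnpos : (0 : ℝ) < n := by exact_mod_cast hn
    rw [mul_assoc]
    have h := card_filter_le_of_exists (ι := Fin n)
      (p := fun G : SimpleGraph (Fin n) => hasUncovered (q + 2) n (edgeString G) = true)
      (r := fun u G => (q + 2) * Nat.log 2 n ≤ u ∧
        ∀ x : Fin n, (x : ℕ) < (q + 2) * Nat.log 2 n → ¬ G.Adj x u)
      (fun G hG => hasUncovered_edgeString.1 hG)
      (b := (2 / n : ℝ) ^ (q + 2) * Fintype.card (SimpleGraph (Fin n))) fun u => ?_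
    · rw [Fintype.card_fin] at h
      convert h
    by_cases hu : (q + 2) * Nat.log 2 n ≤ u
    · simp only [hu, true_and]
      have hS : (Finset.univ.filter fun x : Fin n => (x : ℕ) < (q + 2) * Nat.log 2 n).card =
          (q + 2) * Nat.log 2 n := by
        -- The threshold may exceed `n` in general, but not when some node lies above it.
        rw [Fin.card_filter_val_lt, min_eq_right (hu.trans u.2.le)]
      have h2 := card_no_neighbour_in (V := Fin n)
        (S := Finset.univ.filter fun x : Fin n => (x : ℕ) < (q + 2) * Nat.log 2 n) (v := u)
        (by simpa using hu)
      simp only [Finset.mem_filter, Finset.mem_univ, true_and] at h2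
      rw [hS] at h2
      refine (le_of_eq (b := (1 / 2 : ℝ) ^ ((q + 2) * Nat.log 2 n) *
        Fintype.card (SimpleGraph (Fin n))) (by convert h2)).trans ?_
      rw [mul_comm (q + 2), pow_mul]
      gcongr
      rw [one_div, inv_pow, inv_eq_one_div, div_le_div_iff₀ (by positivity) hnpos, one_mul,
        ← pow_succ']
      exact_mod_cast (Nat.lt_pow_succ_log_self one_lt_two n).le
    · rw [Finset.card_eq_zero.2 (Finset.filter_eq_empty_iff.2 fun G _ hG => hu hG.1)]
      push_cast
      positivity

open Classical in
-- Each of the `n - 2` other nodes fails to be a common neighbour with probability `3/4`; the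
-- constant `16/9` is `(3/4) ^ (-2)`.
theorem eventually_exists_common_neighbour {U : Machine} (hU : U.IsUniversal) {c : ℝ} {q : ℕ}
    (hc : c ≤ q) : ∀ᶠ n : ℕ in atTop,
    ∀ (a : ℕ) (G : SimpleGraph (Fin n)), IsRandomGraph U a (c * Real.logb 2 n) G →
      ∀ u v : Fin n, u ≠ v → ∃ x : Fin n, G.Adj u x ∧ G.Adj x v := by
  have key := eventually_not_bad_of_isRandomGraph hU primrec_hasFarPair hc
    (ε := fun n => (n : ℝ) ^ 2 * (16 / 9 * (3 / 4) ^ n))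
    (tendsto_pow_mul_pow_mul_geometric q 2 _ (by norm_num) (by norm_num)) ?_
  · filter_upwards [key] with n hn a G hG
    have hlt : ∀ u v : Fin n, u < v → ∃ x : Fin n, G.Adj u x ∧ G.Adj x v := by
      intro u v huv
      by_contra hcon
      exact Bool.false_ne_true ((hn a G hG).symm.trans
        (hasFarPair_edgeString.2 ⟨u, v, huv, not_exists.1 hcon⟩))
    intro u v huv
    rcases lt_or_gt_of_ne huv with h | h
    · exact hlt u v h
    · obtain ⟨x, h1, h2⟩ := hlt v u h
      exact ⟨x, h2.symm, h1.symm⟩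
  · refine Eventually.of_forall fun n => ?_
    rw [mul_assoc]
    have h := card_filter_le_of_exists (ι := Fin n × Fin n)
      (p := fun G : SimpleGraph (Fin n) => hasFarPair n (edgeString G) = true)
      (r := fun e G => e.1 < e.2 ∧ ∀ x : Fin n, ¬ (G.Adj e.1 x ∧ G.Adj x e.2))
      (fun G hG => by
        obtain ⟨u, v, h⟩ := hasFarPair_edgeString.1 hG
        exact ⟨(u, v), h⟩)
      (b := 16 / 9 * (3 / 4 : ℝ) ^ n * Fintype.card (SimpleGraph (Fin n))) fun ⟨u, v⟩ => ?_
    · rw [Fintype.card_prod, Fintype.card_fin, Nat.cast_mul, ← sq] at h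
      convert h
    by_cases huv : u < v
    · have h2 := card_no_common_neighbour_in (S := Finset.univ \ {u, v}) huv.ne (by simp)
        (by simp)
      have hS : (Finset.univ \ {u, v} : Finset (Fin n)).card + 2 = n := by
        have := Finset.card_sdiff_add_card_eq_card (Finset.subset_univ {u, v})
        rwa [Finset.card_pair huv.ne, Finset.card_univ, Fintype.card_fin] at this
      have hpow : 16 / 9 * (3 / 4 : ℝ) ^ n =
          (3 / 4) ^ (Finset.univ \ {u, v} : Finset (Fin n)).card := by
        conv_lhs => rw [← hS, pow_add]
        ring
      rw [hpow]
      refine le_of_le_of_eq (b := ((Finset.univ.filter fun G : SimpleGraph (Fin n) =>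
        ∀ x ∈ Finset.univ \ {u, v}, ¬ (G.Adj u x ∧ G.Adj x v)).card : ℝ)) ?_ (by convert h2)
      refine Nat.cast_le.2 (Finset.card_le_card fun G hG => ?_)
      rw [Finset.mem_filter] at hG ⊢
      exact ⟨hG.1, fun x _ => hG.2.2 x⟩
    · rw [Finset.card_eq_zero.2 (Finset.filter_eq_empty_iff.2 fun G _ hG => huv hG.1)]
      push_cast
      positivity

open Classical in
-- The moment bound `2 ^ n` is divided by `(4/3) ^ (3n - k)`, and `2 * (3/4) ^ 3 = 27/32 < 1`. The
-- reserve `k` is for the translation into the language of the routing machine.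
theorem eventually_relayIndex_sum_le {U : Machine} (hU : U.IsUniversal) {c : ℝ} {q : ℕ}
    (hc : c ≤ q) (k : ℕ) : ∀ᶠ n : ℕ in atTop,
    ∀ (a : ℕ) (G : SimpleGraph (Fin n)), IsRandomGraph U a (c * Real.logb 2 n) G →
      ∀ w : Fin n, k + ∑ v, (relayIndex (List.finRange n) G w v + 1) ≤ 3 * n := by
  have key := eventually_not_bad_of_isRandomGraph hU (primrec_hasLongCode k) hc
    (ε := fun n => (n : ℝ) ^ 1 * ((4 / 3) ^ k * (27 / 32) ^ n))
    (tendsto_pow_mul_pow_mul_geometric q 1 _ (by norm_num) (by norm_num)) ?_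
  · filter_upwards [key] with n hn a G hG w
    by_contra! hcon
    exact Bool.false_ne_true ((hn a G hG).symm.trans (hasLongCode_edgeString.2 ⟨w, hcon⟩))
  · refine Eventually.of_forall fun n => ?_
    rw [mul_assoc, pow_one]
    have h := card_filter_le_of_exists (ι := Fin n)
      (p := fun G : SimpleGraph (Fin n) => hasLongCode k n (edgeString G) = true)
      (r := fun w G => 3 * n < k + ∑ v, (relayIndex (List.finRange n) G w v + 1))
      (fun G hG => hasLongCode_edgeString.1 hG)
      (b := (4 / 3 : ℝ) ^ k * (27 / 32) ^ n * Fintype.card (SimpleGraph (Fin n))) fun w => ?_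
    · rw [Fintype.card_fin] at h
      convert h
    have h1 : ((Finset.univ.filter fun G : SimpleGraph (Fin n) =>
        3 * n + 1 - k ≤ ∑ v, (relayIndex (List.finRange n) G w v + 1)).card : ℝ) *
        (4 / 3) ^ (3 * n + 1 - k) ≤ 2 ^ n * Fintype.card (SimpleGraph (Fin n)) := by
      have h := card_relayIndex_ge_le (List.nodup_finRange n) (List.mem_finRange ·) w
        (3 * n + 1 - k)
      rw [Fintype.card_fin] at h
      convert h
    have h2 : (Finset.univ.filter fun G : SimpleGraph (Fin n) =>
        3 * n < k + ∑ v, (relayIndex (List.finRange n) G w v + 1)).card ≤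
        (Finset.univ.filter fun G : SimpleGraph (Fin n) =>
          3 * n + 1 - k ≤ ∑ v, (relayIndex (List.finRange n) G w v + 1)).card :=
      Finset.card_le_card fun G hG => by
        rw [Finset.mem_filter] at hG ⊢
        exact ⟨hG.1, by omega⟩
    -- Valid also when the subtraction is truncated.
    have h3 : (4 / 3 : ℝ) ^ (3 * n) ≤ (4 / 3) ^ (3 * n + 1 - k) * (4 / 3) ^ k := by
      rw [← pow_add]
      exact pow_le_pow_right₀ (by norm_num) (by omega)
    refine (Nat.cast_le (α := ℝ).2 h2).trans ?_
    set D : ℝ := ((Finset.univ.filter fun G : SimpleGraph (Fin n) =>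
      3 * n + 1 - k ≤ ∑ v, (relayIndex (List.finRange n) G w v + 1)).card : ℝ)
    have h4 : (27 / 32 : ℝ) ^ n * (4 / 3) ^ (3 * n) = 2 ^ n := by
      rw [pow_mul, ← mul_pow]
      norm_num
    refine le_of_mul_le_mul_right ?_ (show (0 : ℝ) < (4 / 3) ^ (3 * n) by positivity)
    calc D * (4 / 3) ^ (3 * n) ≤ D * ((4 / 3) ^ (3 * n + 1 - k) * (4 / 3) ^ k) :=
          mul_le_mul_of_nonneg_left h3 (Nat.cast_nonneg _)
      _ = (D * (4 / 3) ^ (3 * n + 1 - k)) * (4 / 3) ^ k := by ring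
      _ ≤ (2 ^ n * Fintype.card (SimpleGraph (Fin n))) * (4 / 3) ^ k :=
          mul_le_mul_of_nonneg_right h1 (by positivity)
      _ = _ := by rw [← h4]; ring

/-! ### The routing scheme -/

section Scheme

variable {n : ℕ} {G : SimpleGraph (Fin n)}

theorem neighbourLabels_eq_map (G : SimpleGraph (Fin n)) (u : Fin n) :
    neighbourLabels G u = (orderedNeighbours (List.finRange n) G u).map label := rfl

theorem mem_orderedNeighbours {u x : Fin n} :
    x ∈ orderedNeighbours (List.finRange n) G u ↔ G.Adj u x := by
  simp [orderedNeighbours]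

theorem label_injective : Function.Injective (label : Fin n → ℕ) := fun _ _ h =>
  Fin.ext (Nat.succ.inj h)

theorem mem_neighbourLabels {u v : Fin n} : label v ∈ neighbourLabels G u ↔ G.Adj u v := by
  rw [neighbourLabels_eq_map, List.mem_map_of_injective label_injective, mem_orderedNeighbours]

theorem routeStep_of_adj {u v : Fin n} (p : List Bool) (h : G.Adj u v) :
    routeStep p (neighbourLabels G u) (label v) = label v := by
  have : (neighbourLabels G u).any (fun x => decide (x = label v)) = true :=
    List.any_eq_true.2 ⟨_, mem_neighbourLabels.2 h, by simp⟩
  rw [routeStep, this, cond_true]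

theorem routeStep_of_not_adj {u v : Fin n} (p : List Bool) (h : ¬ G.Adj u v) :
    routeStep p (neighbourLabels G u) (label v) =
      (neighbourLabels G u).getD ((unaryDecode p).getD v 0) 0 := by
  have : (neighbourLabels G u).any (fun x => decide (x = label v)) = false := by
    rw [List.any_eq_false]
    rintro x hx hxv
    rw [decide_eq_true_eq] at hxv
    exact h (mem_neighbourLabels.1 (hxv ▸ hx))
  rw [routeStep, this, cond_false]
  -- Labels start at `1` and list places at `0`, so `label v - 1` is `v`.
  rfl

/-- Without a program, messages for remote destinations go to the least neighbour. -/
theorem exists_routeStep_nil_eq {u v y : Fin n} (h : ¬ G.Adj u v) (hy : G.Adj u y) :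
    ∃ w, G.Adj u w ∧ w ≤ y ∧ routeStep [] (neighbourLabels G u) (label v) = label w := by
  have hmem := mem_orderedNeighbours.2 hy
  have hsort : (orderedNeighbours (List.finRange n) G u).Pairwise (· < ·) :=
    (List.pairwise_lt_finRange n).filter _
  rw [routeStep_of_not_adj [] h, neighbourLabels_eq_map]
  rcases hL : orderedNeighbours (List.finRange n) G u with _ | ⟨w, l⟩
  · simp [hL] at hmem
  · refine ⟨w, mem_orderedNeighbours.1 (by simp [hL]), ?_, rfl⟩
    rw [hL] at hmem hsort
    rcases List.mem_cons.1 hmem with rfl | hyl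
    · exact le_rfl
    · exact ((List.pairwise_cons.1 hsort).1 y hyl).le

/-- The unary code of the relays leads to remote destinations in two steps. -/
theorem exists_routeStep_relay_eq {u v y : Fin n} (huv : u ≠ v) (h : ¬ G.Adj u v)
    (hy : G.Adj u y) (hyv : G.Adj y v) :
    ∃ x, G.Adj u x ∧ G.Adj x v ∧
      routeStep (unaryCode (relayList n (natAdj G) u)) (neighbourLabels G u) (label v) =
        label x := by
  have hidx : relayIndex (List.finRange n) G u v <
      (orderedNeighbours (List.finRange n) G u).length := by
    rw [relayIndex, if_neg (not_or.2 ⟨huv.symm, h⟩), firstIndex, List.findIdx_lt_length]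
    exact ⟨y, mem_orderedNeighbours.2 hy, by simpa using hyv⟩
  refine ⟨(orderedNeighbours (List.finRange n) G u)[relayIndex (List.finRange n) G u v],
    mem_orderedNeighbours.1 (List.getElem_mem hidx), ?_, ?_⟩
  · have hfind : relayIndex (List.finRange n) G u v =
        (orderedNeighbours (List.finRange n) G u).findIdx fun x => @decide (G.Adj x v)
          (Classical.propDecidable _) := by
      rw [relayIndex, if_neg (not_or.2 ⟨huv.symm, h⟩), firstIndex]
    have h2 := List.findIdx_getElem (w := hfind ▸ hidx)
    simp only [← hfind, decide_eq_true_eq] at h2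
    exact h2
  · have hrelay : (relayList n (natAdj G) u).getD v 0 = relayIndex (List.finRange n) G u v := by
      rw [relayList_natAdj, List.getD_eq_getElem _ _ (by simp), List.getElem_map,
        List.getElem_finRange]
      rfl
    rw [routeStep_of_not_adj _ h, unaryDecode_unaryCode, hrelay, neighbourLabels_eq_map,
      List.getD_eq_getElem _ _ (by simpa using hidx), List.getElem_map]

/-- If the nodes below `m` store their relays and meet every neighbourhood, and any two nodes have
a common neighbour, then the scheme has stretch `3/2`. -/
theorem hasStretchAtMost_of_routeStep {R : Machine} {F : Fin n → List Bool}
    {P : Fin n → List Bool} {m : ℕ}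
    (hF : ∀ u y, R (F u) y = Part.some
      (routeStep (P u) (Denumerable.ofNat (ℕ × List ℕ × ℕ) y).2.1
        (Denumerable.ofNat (ℕ × List ℕ × ℕ) y).2.2))
    (hcentre : ∀ u : Fin n, (u : ℕ) < m → P u = unaryCode (relayList n (natAdj G) u))
    (hother : ∀ u : Fin n, m ≤ (u : ℕ) → P u = [])
    (hnbr : ∀ u : Fin n, m ≤ (u : ℕ) → ∃ x : Fin n, (x : ℕ) < m ∧ G.Adj x u)
    (hcommon : ∀ u v : Fin n, u ≠ v → ∃ x, G.Adj u x ∧ G.Adj x v) :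
    HasStretchAtMost R G F (3 / 2) := by
  have hfwd : ∀ {u v w : Fin n}, G.Adj u w →
      routeStep (P u) (neighbourLabels G u) (label v) = label w → Forwards R G F v u w := by
    intro u v w huw h
    refine ⟨huw, ?_⟩
    rw [hF, Denumerable.ofNat_encode, h]
    exact Part.mem_some _
  have hone : ∀ u v : Fin n, G.Adj u v → Route R G F v u 1 := fun u v h =>
    Route.step h.ne (hfwd h (routeStep_of_adj _ h)) Route.arrive
  have htwo : ∀ u v : Fin n, (u : ℕ) < m → u ≠ v → ¬ G.Adj u v → Route R G F v u 2 := by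
    intro u v hu huv h
    obtain ⟨y, hy, hyv⟩ := hcommon u v huv
    obtain ⟨x, hx, hxv, hstep⟩ := exists_routeStep_relay_eq huv h hy hyv
    rw [← hcentre u hu] at hstep
    exact Route.step huv (hfwd hx hstep) (hone x v hxv)
  have hthree : ∀ u v : Fin n, u ≠ v → ¬ G.Adj u v → ∃ k, Route R G F v u k ∧ k ≤ 3 := by
    intro u v huv h
    rcases lt_or_ge (u : ℕ) m with hu | hu
    · exact ⟨2, htwo u v hu huv h, by norm_num⟩
    · obtain ⟨y, hym, hy⟩ := hnbr u hu
      -- The least neighbour `w` need not be `y`, but `w ≤ y < m` makes it a centre.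
      obtain ⟨w, hw, hwy, hstep⟩ := exists_routeStep_nil_eq h hy.symm
      rw [← hother u hu] at hstep
      have hwv : w ≠ v := fun he => h (he ▸ hw)
      by_cases hadj : G.Adj w v
      · exact ⟨2, Route.step huv (hfwd hw hstep) (hone w v hadj), by norm_num⟩
      · exact ⟨3, Route.step huv (hfwd hw hstep)
          (htwo w v (lt_of_le_of_lt hwy hym) hwv hadj), le_rfl⟩
  intro u v huv
  by_cases h : G.Adj u v
  · refine ⟨1, hone u v h, ?_⟩
    rw [SimpleGraph.dist_eq_one_iff_adj.2 h]
    norm_num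
  · obtain ⟨k, hk, hk3⟩ := hthree u v huv h
    refine ⟨k, hk, ?_⟩
    obtain ⟨x, hx, hxv⟩ := hcommon u v huv
    -- `dist` is `0` between unreachable nodes; the common neighbour rules this out.
    have hpos : 0 < G.dist u v := (hx.reachable.trans hxv.reachable).pos_dist_of_ne huv
    have hne : G.dist u v ≠ 1 := fun h1 => h (SimpleGraph.dist_eq_one_iff_adj.1 h1)
    have h2 : (2 : ℝ) ≤ G.dist u v := by exact_mod_cast (show 2 ≤ G.dist u v by omega)
    have h3 : (k : ℝ) ≤ 3 := by exact_mod_cast hk3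
    linarith

end Scheme

end CompactRouting

/-! ### Assembling the scheme and adding up its cost -/

theorem mainTheorem10 (U R : CompactRouting.Machine) (hU : U.IsUniversal) (hR : R.IsUniversal)
    (c : ℝ) (hc : 0 ≤ c) :
    ∃ n₀ : ℕ, ∀ n : ℕ, n₀ ≤ n → ∀ (a : ℕ) (G : SimpleGraph (Fin n)),
      CompactRouting.IsRandomGraph U a (c * Real.logb 2 (n : ℝ)) G →
        ∃ (F : Fin n → List Bool) (B : Finset (Fin n)),
          CompactRouting.HasStretchAtMost R G F (3 / 2) ∧
          (B.card : ℝ) ≤ 1 + (c + 3) * Real.logb 2 (n : ℝ) ∧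
          (∀ u : Fin n, u ∉ B → (F u).length ≤ ⌈Real.logb 2 ((n : ℝ) + 1)⌉₊) ∧
          (∀ u : Fin n, u ∈ B → (F u).length ≤ 3 * n) ∧
          (∑ u : Fin n, ((F u).length : ℝ)) < (3 * c + 20) * (n : ℝ) * Real.logb 2 (n : ℝ) := by
  open CompactRouting in
  obtain ⟨k, hk⟩ := exists_simulation hR primrec_routeStep
  choose t ht using hk
  have hq : c ≤ (⌈c⌉₊ : ℕ) := Nat.le_ceil c
  set q := ⌈c⌉₊ with hqdef
  refine Filter.eventually_atTop.1 ?_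
  filter_upwards [eventually_exists_neighbour_lt hU hq, eventually_exists_common_neighbour hU hq,
    -- The simulation constant `k` of `R` is the reserve below `3 * n` at the centres; `n ≥ 2 ^ (k +
    -- 1)` makes it fit under `log n` at the other nodes.
    eventually_relayIndex_sum_le hU hq k, Filter.eventually_ge_atTop (2 ^ (k + 1))]
    with n h1 h2 h3 hn a G hG
  set m := (q + 2) * Nat.log 2 n with hm
  let P : Fin n → List Bool := fun u =>
    if (u : ℕ) < m then unaryCode (relayList n (natAdj G) u) else []
  have hnR : (2 : ℝ) ^ (k + 1) ≤ n := by exact_mod_cast hn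
  have hnpos : (0 : ℝ) < n := lt_of_lt_of_le (by positivity) hnR
  have hklog : (k : ℝ) + 1 ≤ Real.logb 2 n := by
    rw [Real.le_logb_iff_rpow_le one_lt_two hnpos]
    exact_mod_cast hnR
  have hk0 : (0 : ℝ) ≤ k := Nat.cast_nonneg k
  have hmlog : (m : ℝ) ≤ (c + 3) * Real.logb 2 n := by
    have hq1 : (q : ℝ) < c + 1 := Nat.ceil_lt_add_one hc
    have hl : (Nat.log 2 n : ℝ) ≤ Real.logb 2 n := by
      exact_mod_cast Real.natLog_le_logb n 2
    rw [hm]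
    push_cast
    exact mul_le_mul (by linarith) hl (Nat.cast_nonneg _) (by linarith)
  let B : Finset (Fin n) := Finset.univ.filter fun u => (u : ℕ) < m
  have hB : (B.card : ℝ) ≤ m := by
    have : B.card ≤ m := by
      rw [Fin.card_filter_val_lt]
      exact min_le_right _ _
    exact_mod_cast this
  have hcentre : ∀ u ∈ B, (t (P u)).length ≤ 3 * n := by
    intro u hu
    have hu' : (u : ℕ) < m := by simpa [B] using hu
    have h4 := (ht (P u)).1
    rw [show P u = unaryCode (relayList n (natAdj G) u) from if_pos hu'] at h4 ⊢
    rw [length_unaryCode_relayList] at h4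
    linarith [h3 a G hG u]
  have hother : ∀ u ∉ B, (t (P u)).length ≤ k := by
    intro u hu
    have hu' : ¬ (u : ℕ) < m := by simpa [B] using hu
    have h4 := (ht (P u)).1
    rw [show P u = [] from if_neg hu'] at h4 ⊢
    simpa using h4
  refine ⟨fun u => t (P u), B, ?_, by linarith, fun u hu => ?_, hcentre, ?_⟩
  · exact hasStretchAtMost_of_routeStep (P := P) (m := m) (fun u y => (ht (P u)).2 y)
      (fun u hu => if_pos hu) (fun u hu => if_neg (not_lt.2 hu)) (h1 a G hG) (h2 a G hG)
  · have hlog : Real.logb 2 (n : ℝ) ≤ Real.logb 2 ((n : ℝ) + 1) :=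
      Real.logb_le_logb_of_le one_lt_two hnpos (by linarith)
    refine (hother u hu).trans ?_
    have h4 : (k : ℝ) ≤ ⌈Real.logb 2 ((n : ℝ) + 1)⌉₊ := by
      linarith [Nat.le_ceil (Real.logb 2 ((n : ℝ) + 1))]
    exact_mod_cast h4
  · have hsum : ∑ u : Fin n, ((t (P u)).length : ℝ) ≤ B.card * (3 * n) + n * k := by
      rw [← Finset.sum_add_sum_compl B]
      refine add_le_add ?_ ?_
      · rw [← nsmul_eq_mul]
        exact Finset.sum_le_card_nsmul _ _ _ fun u hu => by exact_mod_cast hcentre u hu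
      · refine (Finset.sum_le_card_nsmul _ _ (k : ℝ) fun u hu => ?_).trans ?_
        · exact_mod_cast hother u (Finset.mem_compl.1 hu)
        · rw [nsmul_eq_mul]
          refine mul_le_mul_of_nonneg_right ?_ hk0
          exact_mod_cast (Finset.card_le_univ _).trans (Fintype.card_fin n).le
    have h4 : (B.card : ℝ) * (3 * n) ≤ (c + 3) * Real.logb 2 n * (3 * n) :=
      mul_le_mul_of_nonneg_right (hB.trans hmlog) (by positivity)
    -- The centres use `3 (c + 3) n log n` bits; `11` is what remains of `3 c + 20`.
    have h5 : (n : ℝ) * k < n * (11 * Real.logb 2 n) :=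
      mul_lt_mul_of_pos_left (by linarith) hnpos
    calc _ ≤ (B.card : ℝ) * (3 * n) + n * k := hsum
      _ < (c + 3) * Real.logb 2 n * (3 * n) + n * (11 * Real.logb 2 n) := by linarith
      _ = _ := by ring
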